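/- Throughout, growth functions have domain $\{1,2,3,\dots\}$ and values in $\{0,1,2,\dots\}$, and $F_1\preceq F_2$ means that there is a positive integer $K$ with $F_1(l)\le K\,F_2(Kl)$ for all integers $l\ge 1$; $F_1\succeq F_2$ means $F_2\preceq F_1$. A group $\Gamma$ is lawless if for every $k$ and every nontrivial element $w$ of the free group $F_k$ of rank $k$ there is a homomorphism $F_k\to\Gamma$ that does not kill $w$. Let $\Gamma$ be a lawless group generated by a finite set $S$, with word length $|\cdot|_S$, and let $k\ge 2$. For $1\ne w\in F_k$ put \[ \chi_\Gamma^S(w)=\min\Big\{\sum_{i=1}^k |g_i|_S : g_1,\dots,g_k\in\Gamma,\ w(g_1,\dots,g_k)\neq e\Big\}, \] and define the lawlessness growth of $\Gamma$ (computed in $F_k$) by \[ \mathcal A_{\Gamma,k}^S(l)=\max\{\chi_\Gamma^S(w): 1\ne w\in F_k,\ |w|\le l\}\qquad(l\ge 1), \] where $|w|$ is the word length of $w$ with respect to the fixed free basis of $F_k$. The class of elementary amenable groups is the smallest class of groups containing all finite groups and $\mathbb Z$ and closed under subgroups, quotients, extensions and directed limits. Theorem. Let $f$ be an unbounded nondecreasing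 function from $\{1,2,3,\dots\}$ to $\{0,1,2,\dots\}$. Then there exist an elementary amenable lawless group $\Gamma$ and a finite generating set $S$ of $\Gamma$ such that $\mathcal A_{\Gamma,k}^S\succeq f$ for every $k\ge 2$. -/

import Mathlib

/-- The class of elementary amenable groups: the smallest class of groups containing all finite
groups and the infinite cyclic group, and closed under subgroups, quotients, extensions and
directed limits. Subgroups and quotients are taken up to isomorphism (injective, respectively
surjective, homomorphisms), so that the class is isomorphism-invariant. -/
inductive IsElementaryAmenable : (G : Type) → [Group G] → Prop
  | of_finite (G : Type) [Group G] [Finite G] : IsElementaryAmenable G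
  | int : IsElementaryAmenable (Multiplicative ℤ)
  | of_injective {G H : Type} [Group G] [Group H] (φ : H →* G) (hφ : Function.Injective φ) :
      IsElementaryAmenable G → IsElementaryAmenable H
  | of_surjective {G Q : Type} [Group G] [Group Q] (φ : G →* Q) (hφ : Function.Surjective φ) :
      IsElementaryAmenable G → IsElementaryAmenable Q
  | of_extension {G : Type} [Group G] (N : Subgroup G) [N.Normal] :
      IsElementaryAmenable N → IsElementaryAmenable (G ⧸ N) → IsElementaryAmenable G
  | of_directLimit {ι : Type} [Preorder ι] [IsDirectedOrder ι] [Nonempty ι]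
      (G : ι → Type) [∀ i, Group (G i)] (φ : ∀ i j, i ≤ j → G i →* G j)
      [DirectedSystem G (φ · · ·)] :
      (∀ i, IsElementaryAmenable (G i)) → IsElementaryAmenable (DirectLimit G φ)

/-- The set of laws for `Γ` in the free group of rank `k`: the nontrivial elements lying in the
kernel of every homomorphism to `Γ`. -/
def groupLaws (Γ : Type*) [Group Γ] (k : ℕ) : Set (FreeGroup (Fin k)) :=
  {w | w ≠ 1 ∧ ∀ π : FreeGroup (Fin k) →* Γ, π w = 1}

/-- A group is lawless if it has no laws, in any number of variables. -/
def IsLawless (Γ : Type*) [Group Γ] : Prop :=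
  ∀ k : ℕ, groupLaws Γ k = ∅

/-- The word length `|g|_S` of `g` with respect to a generating set `S`: the least length of a
product of elements of `S ∪ S⁻¹` equal to `g`. -/
noncomputable def wordLength {Γ : Type*} [Group Γ] (S : Set Γ) (g : Γ) : ℕ :=
  sInf {n : ℕ | ∃ u : List Γ, (∀ x ∈ u, x ∈ S ∨ x⁻¹ ∈ S) ∧ u.prod = g ∧ u.length = n}

/-- The complexity of a non-law `w`: the least total word length `∑ |g i|_S` of a tuple `g` with
`w (g 0, …, g (k - 1)) ≠ 1`. -/
noncomputable def wordComplexity {Γ : Type*} [Group Γ] (S : Set Γ) {k : ℕ}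
    (w : FreeGroup (Fin k)) : ℕ :=
  sInf {n : ℕ | ∃ g : Fin k → Γ, FreeGroup.lift g w ≠ 1 ∧ ∑ i, wordLength S (g i) = n}

/-- The `W`-lawlessness growth: the maximal complexity of the elements of `W` of length at most
`l` in the free group. This is a supremum over a finite set. -/
noncomputable def lawlessnessGrowthOn {Γ : Type*} [Group Γ] (S : Set Γ) {k : ℕ}
    (W : Set (FreeGroup (Fin k))) (l : ℕ+) : ℕ :=
  sSup (wordComplexity S '' {w | w ∈ W ∧ w.norm ≤ (l : ℕ)})

/-- The lawlessness growth of a lawless group with respect to `S`, computed in the free group of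
rank `k`, that is, with `W` the set of all nontrivial elements. -/
noncomputable def lawlessnessGrowth {Γ : Type*} [Group Γ] (S : Set Γ) (k : ℕ) : ℕ+ → ℕ :=
  lawlessnessGrowthOn S {w : FreeGroup (Fin k) | w ≠ 1}

/-- `F₁ ⪯ F₂`: there is a positive integer `K` with `F₁ l ≤ K * F₂ (K * l)` for all `l ≥ 1`. -/
def GrowthLE (F₁ F₂ : ℕ+ → ℕ) : Prop :=
  ∃ K : ℕ+, ∀ l : ℕ+, F₁ l ≤ K * F₂ (K * l)

/-! ### Closure properties of elementary amenable groups. -/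

namespace IsElementaryAmenable

/-! The group lives in the wreath product of `Perm ℕ` by ℤ. One generator carries the transposition
`(0 j+1)` at position `p j` for every `j`, with `p` very sparse; the others are the shift and `(0
1)` at the origin. An element of length `n` sees, at each position, only lamps within distance `n`.
If the gaps beyond lamp `J` exceed `2n`, these are either a single involution or lamps of index at
most `J`, which act on `J + 2` points (`window_dichotomy`). So `⁅a, b⁆ ^ (J + 2)!` vanishes on all
short tuples (`commutator_pow_eq_one`), and the gaps can be chosen after its length to beat `f`.

Conjugating at the origin produces every transposition, hence all finite symmetric groups, and free
groups are residually finite: no laws. Modulo finitely many positions, the base group has exponent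
two; the remaining finitely supported part is a directed union of finite groups. This gives
elementary amenability. -/

theorem of_ker_of_range {G G' : Type} [Group G] [Group G'] (φ : G →* G')
    (hk : IsElementaryAmenable φ.ker) (hr : IsElementaryAmenable φ.range) :
    IsElementaryAmenable G :=
  of_extension φ.ker hk
    (of_injective (QuotientGroup.quotientKerEquivRange φ).toMonoidHom
      (QuotientGroup.quotientKerEquivRange φ).injective hr)

/-- A directed union of elementary amenable subgroups is elementary amenable. -/
theorem of_directed_union {G ι : Type} [Group G] [Preorder ι] [IsDirectedOrder ι] [Nonempty ι]
    (K : ι → Subgroup G) (hK : Monotone K) (hG : ∀ g, ∃ i, g ∈ K i)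
    (h : ∀ i, IsElementaryAmenable (K i)) : IsElementaryAmenable G := by
  let φ : ∀ i j, i ≤ j → K i →* K j := fun i j hij => Subgroup.inclusion (hK hij)
  have : DirectedSystem (fun i => K i) (φ · · ·) :=
    ⟨fun i x => rfl, fun i j k hij hjk x => rfl⟩
  let F : DirectLimit (fun i => K i) φ →* G :=
    { toFun := DirectLimit.lift _ (fun i x => (K i).subtype x) (fun i j hij x => rfl)
      map_one' := DirectLimit.lift_one (fun i => (K i).subtype) (fun i j hij x => rfl)
      map_mul' := DirectLimit.lift_mul (fun i => (K i).subtype) (fun i j hij x => rfl) }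
  refine of_surjective F (fun g => ?_) (of_directLimit (fun i => K i) φ h)
  obtain ⟨i, hi⟩ := hG g
  exact ⟨Quotient.mk _ ⟨i, ⟨g, hi⟩⟩, rfl⟩

/-- Groups of exponent two are elementary amenable. -/
theorem of_sq_eq_one {G : Type} [Group G] (h : ∀ g : G, g ^ 2 = 1) : IsElementaryAmenable G := by
  classical
  let : CommGroup G := { mul_comm := fun a b =>
    Commute.of_orderOf_dvd_two (fun g => orderOf_dvd_of_pow_eq_one (h g)) a b }
  refine of_directed_union (ι := Finset G) (fun s => Subgroup.closure (s : Set G))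
    (fun s t hst => Subgroup.closure_mono (by simpa using hst))
    (fun g => ⟨{g}, Subgroup.subset_closure (by simp)⟩) (fun s => ?_)
  have : Group.FG (Subgroup.closure (s : Set G)) := Group.closure_finset_fg s
  have : Finite (Subgroup.closure (s : Set G)) :=
    CommGroup.finite_of_fg_isMulTorsion _ fun x => isOfFinOrder_iff_pow_eq_one.2
      ⟨2, by norm_num, Subtype.ext (h x)⟩
  exact of_finite _

end IsElementaryAmenable

/-! ### Residual finiteness of free groups and symmetric groups. -/

theorem FreeGroup.finite_norm_le {α : Type*} [DecidableEq α] [Finite α] (n : ℕ) :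
    {w : FreeGroup α | w.norm ≤ n}.Finite :=
  Set.Finite.of_finite_image ((List.finite_length_le (α × Bool) n).subset
    (by rintro _ ⟨w, hw, rfl⟩; exact hw)) FreeGroup.toWord_injective.injOn

/-- Free groups of finite rank are residually finite. -/
theorem FreeGroup.exists_perm_lift_ne_one {α : Type} [Finite α] (w : FreeGroup α) (hw : w ≠ 1) :
    ∃ (X : Type) (_ : Finite X) (σ : α → Equiv.Perm X), FreeGroup.lift σ w ≠ 1 := by
  classical
  -- Left multiplication by a generator is a partial injection of this finite ball; extend it to a
  -- permutation.
  let X : Type := {v : FreeGroup α // v.norm ≤ w.norm}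
  have hX : Finite X := FreeGroup.finite_norm_le w.norm
  have hσ : ∀ i : α, ∃ σ : Equiv.Perm X, ∀ x y : X, y.1 = FreeGroup.of i * x.1 → σ x = y := by
    intro i
    obtain ⟨σ, hσ⟩ := Equiv.Perm.exists_extending_pair
      (α := {x : X // (FreeGroup.of i * x.1).norm ≤ w.norm}) (β := X)
      (fun x => x.1) (fun x => ⟨FreeGroup.of i * x.1.1, x.2⟩) Subtype.val_injective
      (fun x y hxy => Subtype.ext (Subtype.ext (mul_left_cancel (congrArg Subtype.val hxy))))
    refine ⟨σ, fun x y hxy => ?_⟩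
    rw [hσ ⟨x, hxy ▸ y.2⟩]
    exact Subtype.ext hxy.symm
  choose σ hσ using hσ
  refine ⟨X, hX, σ, fun h1 => hw ?_⟩
  -- Suffixes of the word of `w` stay in the ball, so the word carries `1` to `w`.
  have key : ∀ (L : List (α × Bool)) (hL : L.length ≤ w.norm),
      FreeGroup.lift σ (FreeGroup.mk L) ⟨1, by simp⟩ =
        (⟨FreeGroup.mk L, FreeGroup.norm_mk_le.trans hL⟩ : X) := by
    intro L
    induction L with
    | nil => intro hL; rfl
    | cons s L ih =>
      intro hL
      have hL' : L.length ≤ w.norm := by simp at hL; omega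
      obtain ⟨i, b⟩ := s
      have hmul : FreeGroup.mk ((i, b) :: L) = FreeGroup.mk [(i, b)] * FreeGroup.mk L := by
        rw [FreeGroup.mul_mk]; rfl
      have hl : FreeGroup.lift σ (FreeGroup.mk ((i, b) :: L)) =
        FreeGroup.lift σ (FreeGroup.mk [(i, b)]) * FreeGroup.lift σ (FreeGroup.mk L) := by
        rw [hmul, _root_.map_mul]
      rw [hl, Equiv.Perm.mul_apply, ih hL']
      cases b with
      | true =>
        have : FreeGroup.lift σ (FreeGroup.mk [(i, true)]) = σ i := FreeGroup.lift_apply_of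
        rw [this]
        exact hσ i _ _ hmul
      | false =>
        have : FreeGroup.lift σ (FreeGroup.mk [(i, false)]) = (σ i)⁻¹ := by
          have : FreeGroup.mk [(i, false)] = (FreeGroup.of i)⁻¹ := rfl
          rw [this, _root_.map_inv, FreeGroup.lift_apply_of]
        rw [this, Equiv.Perm.inv_eq_iff_eq]
        refine (hσ i _ _ ?_).symm
        have : FreeGroup.mk [(i, false)] = (FreeGroup.of i)⁻¹ := rfl
        simp only [hmul, this, mul_inv_cancel_left]
  have h2 := key w.toWord le_rfl
  simp only [FreeGroup.mk_toWord, h1, Equiv.Perm.one_apply] at h2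
  exact (congrArg Subtype.val h2).symm

/-- A subgroup of `Perm ℕ` containing all transpositions contains an isomorphic copy of any finite
symmetric group. -/
theorem viaEmbeddingHom_mem_of_swap_mem {X : Type*} [Finite X] (ι : X ↪ ℕ)
    (D : Subgroup (Equiv.Perm ℕ)) (hD : ∀ x y, Equiv.swap x y ∈ D) (σ : Equiv.Perm X) :
    Equiv.Perm.viaEmbeddingHom ι σ ∈ D := by
  classical
  suffices h : (⊤ : Subgroup (Equiv.Perm X)) ≤ D.comap (Equiv.Perm.viaEmbeddingHom ι) from
    h (Subgroup.mem_top σ)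
  rw [← Equiv.Perm.closure_isSwap, Subgroup.closure_le]
  rintro _ ⟨x, y, -, rfl⟩
  have : Equiv.Perm.viaEmbeddingHom ι (Equiv.swap x y) = Equiv.swap (ι x) (ι y) := by
    ext n
    rw [Equiv.Perm.viaEmbeddingHom_apply]
    by_cases hn : n ∈ Set.range ι
    · obtain ⟨z, rfl⟩ := hn
      rw [Equiv.Perm.viaEmbedding_apply, ι.injective.map_swap]
    · rw [Equiv.Perm.viaEmbedding_apply_of_notMem _ _ _ hn, Equiv.swap_apply_of_ne_of_ne]
      · rintro rfl; exact hn ⟨x, rfl⟩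
      · rintro rfl; exact hn ⟨y, rfl⟩
  simpa [this] using hD _ _

/-! ### The lamp group and locality. -/

open Equiv RegularWreathProduct
open scoped commutatorElement

namespace SparseLamp

/-- The lamp group elements: transpositions moving `0`. -/
def lamp (j : ℕ) : Perm ℕ := swap 0 (j + 1)

theorem lamp_mul_self (j : ℕ) : lamp j * lamp j = 1 := swap_mul_self _ _

theorem closure_lamp_le (J : ℕ) : Subgroup.closure (lamp '' Set.Iic J) ≤
    (Perm.ofSubtype (p := fun n : ℕ => n < J + 2)).range := by
  rw [Subgroup.closure_le]
  rintro _ ⟨j, hj, rfl⟩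
  rw [Set.mem_Iic] at hj
  exact ⟨swap ⟨0, by omega⟩ ⟨j + 1, by omega⟩, by rw [Perm.ofSubtype_swap_eq]; rfl⟩

theorem pow_factorial_eq_one {J : ℕ} {g : Perm ℕ}
    (hg : g ∈ Subgroup.closure (lamp '' Set.Iic J)) : g ^ (J + 2).factorial = 1 := by
  obtain ⟨σ, rfl⟩ := closure_lamp_le J hg
  rw [← map_pow]
  have hc : Nat.card (Perm {n : ℕ // n < J + 2}) = (J + 2).factorial := by
    rw [Nat.card_perm]
    congr 1
    simpa using Nat.card_congr (Fin.equivSubtype (n := J + 2)).symm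
  rw [← hc, pow_card_eq_one', map_one]

instance finite_closure_lamp (J : ℕ) : Finite (Subgroup.closure (lamp '' Set.Iic J)) := by
  have : Finite {n : ℕ // n < J + 2} := (Set.finite_Iio (J + 2)).to_subtype
  have : Finite (Perm.ofSubtype (p := fun n : ℕ => n < J + 2)).range :=
    Finite.of_surjective _ (MonoidHom.rangeRestrict_surjective _)
  exact Finite.of_injective _ (Subgroup.inclusion_injective (closure_lamp_le J))

/-- The subgroup generated by the lamps located at distance at most `n` from `x`. -/
def window (p : ℕ → ℕ) (n : ℕ) (x : Multiplicative ℤ) : Subgroup (Perm ℕ) :=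
  Subgroup.closure {h | ∃ j, |(p j : ℤ) - x.toAdd| ≤ n ∧ lamp j = h}

theorem window_mono (p : ℕ → ℕ) {m n : ℕ} {x y : Multiplicative ℤ}
    (h : m + |x.toAdd - y.toAdd| ≤ n) : window p m x ≤ window p n y := by
  refine Subgroup.closure_mono ?_
  rintro _ ⟨j, hj, rfl⟩
  refine ⟨j, ?_, rfl⟩
  have := abs_sub_le (p j : ℤ) x.toAdd y.toAdd
  omega

theorem window_le_closure (p : ℕ → ℕ) {n J : ℕ} {x : Multiplicative ℤ}
    (h : ∀ i, |(p i : ℤ) - x.toAdd| ≤ n → i ≤ J) :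
    window p n x ≤ Subgroup.closure (lamp '' Set.Iic J) := by
  refine Subgroup.closure_mono ?_
  rintro _ ⟨j, hj, rfl⟩
  exact ⟨j, h j hj, rfl⟩

/-- The element `g` only sees lamps at distance at most `n`. -/
def IsLocal (p : ℕ → ℕ) (n : ℕ) (g : Perm ℕ ≀ᵣ Multiplicative ℤ) : Prop :=
  |g.right.toAdd| ≤ n ∧ (∀ x, g.left x ∈ window p n x) ∧ ∀ x, g⁻¹.left x ∈ window p n x

namespace IsLocal

variable {p : ℕ → ℕ} {m n : ℕ} {g k : Perm ℕ ≀ᵣ Multiplicative ℤ}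

theorem one : IsLocal p 0 1 := by
  refine ⟨by simp, fun x => ?_, fun x => ?_⟩
  · exact one_mem _
  · rw [inv_one]; exact one_mem _

/-- Both directions are part of `IsLocal`; deducing one from the other would double the radius. -/
theorem inv (h : IsLocal p n g) : IsLocal p n g⁻¹ := by
  refine ⟨by simpa using h.1, h.2.2, by simpa only [inv_inv] using h.2.1⟩

/-- The second factor is read at a position moved by the translation of `g`, at most `m`. -/
theorem mul (hg : IsLocal p m g) (hk : IsLocal p n k) : IsLocal p (m + n) (g * k) := by
  have aux : ∀ {m n : ℕ} {g k : Perm ℕ ≀ᵣ Multiplicative ℤ}, |g.right.toAdd| ≤ m →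
      (∀ x, g.left x ∈ window p m x) → (∀ x, k.left x ∈ window p n x) →
      ∀ x, (g * k).left x ∈ window p (m + n) x := by
    intro m n g k h1 h2 h3 x
    refine mul_mem (window_mono p (by simp) (h2 x)) (window_mono p ?_ (h3 _))
    simp only [toAdd_mul, toAdd_inv]
    rw [show -g.right.toAdd + x.toAdd - x.toAdd = -g.right.toAdd by ring, abs_neg]
    push_cast; linarith
  refine ⟨?_, aux hg.1 hg.2.1 hk.2.1, ?_⟩
  · have := abs_add_le g.right.toAdd k.right.toAdd
    have h1 := hg.1
    have h2 := hk.1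
    simp only [mul_right, toAdd_mul]
    push_cast; linarith
  · rw [mul_inv_rev, add_comm m n]
    exact aux hk.inv.1 hk.inv.2.1 hg.inv.2.1

theorem list_prod (u : List (Perm ℕ ≀ᵣ Multiplicative ℤ)) (h : ∀ x ∈ u, IsLocal p 1 x) :
    IsLocal p u.length u.prod := by
  induction u with
  | nil => exact one
  | cons s u ih =>
    rw [List.prod_cons, List.length_cons, add_comm]
    exact (h s (by simp)).mul (ih fun x hx => h x (by simp [hx]))

end IsLocal

/-- The generator translating the lamps. -/
def shift : Perm ℕ ≀ᵣ Multiplicative ℤ := ⟨1, Multiplicative.ofAdd 1⟩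

/-- The generator switching the `j`-th lamp at position `p j`, for all `j`. -/
noncomputable def lamps (p : ℕ → ℕ) : Perm ℕ ≀ᵣ Multiplicative ℤ :=
  ⟨Function.extend (fun j => Multiplicative.ofAdd (p j : ℤ)) lamp 1, 1⟩

/-- The embedding of the lamp group at the origin. -/
def atOrigin : Perm ℕ →* Perm ℕ ≀ᵣ Multiplicative ℤ where
  toFun g := ⟨Pi.mulSingle 1 g, 1⟩
  map_one' := by ext <;> simp
  map_mul' g h := by ext <;> simp [Pi.mulSingle_mul]

/-- The generating set. -/
def gens (p : ℕ → ℕ) : Set (Perm ℕ ≀ᵣ Multiplicative ℤ) := {shift, lamps p, atOrigin (lamp 0)}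

/-- The group generated by `gens p`. -/
def lampGroup (p : ℕ → ℕ) : Subgroup (Perm ℕ ≀ᵣ Multiplicative ℤ) := Subgroup.closure (gens p)

theorem isLocal_of_mem_gens {p : ℕ → ℕ} (hp : StrictMono p) (hp0 : p 0 = 0)
    {g : Perm ℕ ≀ᵣ Multiplicative ℤ} (hg : g ∈ gens p) : IsLocal p 1 g := by
  have hinj : Function.Injective (fun j => Multiplicative.ofAdd (p j : ℤ)) := fun i j h =>
    hp.injective (by simpa using h)
  have aux : ∀ {g : Perm ℕ ≀ᵣ Multiplicative ℤ}, g.right = 1 →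
      (∀ x, g.left x ∈ window p 1 x) → IsLocal p 1 g := by
    intro g h1 h2
    refine ⟨by simp [h1], h2, fun x => ?_⟩
    simpa [h1] using h2 x
  rcases hg with rfl | rfl | rfl
  · exact ⟨by simp [shift], fun x => one_mem _, fun x => by simp [shift]⟩
  · refine aux rfl fun x => ?_
    by_cases hx : ∃ j, Multiplicative.ofAdd (p j : ℤ) = x
    · obtain ⟨j, rfl⟩ := hx
      simp only [lamps, hinj.extend_apply]
      exact Subgroup.subset_closure ⟨j, by simp, rfl⟩
    · simp only [lamps, Function.extend_apply' _ _ _ hx]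
      exact one_mem _
  · refine aux rfl fun x => ?_
    by_cases hx : x = 1
    · subst hx
      simp only [atOrigin, MonoidHom.coe_mk, OneHom.coe_mk, Pi.mulSingle_eq_same]
      exact Subgroup.subset_closure ⟨0, by simp [hp0], rfl⟩
    · simp only [atOrigin, MonoidHom.coe_mk, OneHom.coe_mk, Pi.mulSingle_eq_of_ne hx]
      exact one_mem _

theorem exists_isLocal {p : ℕ → ℕ} (hp : StrictMono p) (hp0 : p 0 = 0)
    {g : Perm ℕ ≀ᵣ Multiplicative ℤ} (hg : g ∈ lampGroup p) : ∃ n, IsLocal p n g := by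
  induction hg using Subgroup.closure_induction with
  | mem x hx => exact ⟨1, isLocal_of_mem_gens hp hp0 hx⟩
  | one => exact ⟨0, .one⟩
  | mul x y _ _ hx hy => exact ⟨_, hx.choose_spec.mul hy.choose_spec⟩
  | inv x _ hx => exact ⟨_, hx.choose_spec.inv⟩

/-! ### Sparseness and torsion of commutators. -/

/-- In a short window there is either a single lamp, or only lamps of small index. -/
theorem window_dichotomy {p r : ℕ → ℕ} (hp : StrictMono p) (hr : Monotone r)
    (hgap : ∀ j, p j + 2 * r (j + 1) < p (j + 1)) {n J : ℕ} (hn : n ≤ r (J + 1))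
    (x : Multiplicative ℤ) :
    (∃ i, window p n x ≤ Subgroup.zpowers (lamp i)) ∨
      ∀ i, |(p i : ℤ) - x.toAdd| ≤ n → i ≤ J := by
  by_contra! hcon
  obtain ⟨h1, i, hi, hJi⟩ := hcon
  refine h1 i ?_
  refine (Subgroup.closure_le _).2 ?_
  rintro _ ⟨j, hj, rfl⟩
  -- A lamp of index above `J` is farther than the window's diameter `2n` from every other lamp.
  have hsep : ∀ a b, a < b → J < b → p a + 2 * n < p b := by
    intro a b hab hb
    obtain ⟨c, rfl⟩ : ∃ c, b = c + 1 := ⟨b - 1, by omega⟩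
    have h2 := hgap c
    have h3 : r (J + 1) ≤ r (c + 1) := hr (by omega)
    have h4 : p a ≤ p c := hp.monotone (by omega)
    omega
  rw [abs_le] at hi hj
  have hij : i = j := by
    rcases lt_trichotomy i j with h | h | h
    · have := hsep i j h (by omega)
      omega
    · exact h
    · have := hsep j i h hJi
      omega
  subst hij
  exact Subgroup.mem_zpowers _

theorem sq_eq_one_of_mem_zpowers {i : ℕ} {g : Perm ℕ} (hg : g ∈ Subgroup.zpowers (lamp i)) :
    g ^ 2 = 1 := by
  obtain ⟨z, rfl⟩ := hg
  simp only
  rw [← zpow_natCast, ← zpow_mul, mul_comm, zpow_mul, zpow_natCast, pow_two, lamp_mul_self,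
    one_zpow]

theorem pow_factorial_eq_one_of_mem_window {p r : ℕ → ℕ} (hp : StrictMono p) (hr : Monotone r)
    (hgap : ∀ j, p j + 2 * r (j + 1) < p (j + 1)) {n J : ℕ} (hn : n ≤ r (J + 1))
    {x : Multiplicative ℤ} {g : Perm ℕ} (hg : g ∈ window p n x) :
    g ^ (J + 2).factorial = 1 := by
  rcases window_dichotomy hp hr hgap hn x with ⟨i, hi⟩ | h
  · obtain ⟨c, hc⟩ : 2 ∣ (J + 2).factorial := Nat.dvd_factorial (by norm_num) (by omega)
    rw [hc, pow_mul, sq_eq_one_of_mem_zpowers (hi hg), one_pow]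
  · exact pow_factorial_eq_one (window_le_closure p h hg)

theorem pow_left {g : Perm ℕ ≀ᵣ Multiplicative ℤ} (hg : g.right = 1) (N : ℕ) :
    (g ^ N).left = g.left ^ N ∧ (g ^ N).right = 1 := by
  induction N with
  | zero => simp
  | succ N ih => simp [pow_succ, ih.1, ih.2, hg]

/-- Translations cancel in a commutator, so its powers are taken positionwise, inside windows of
radius `2 * (m + n)`. -/
theorem commutator_pow_eq_one {p r : ℕ → ℕ} (hp : StrictMono p) (hr : Monotone r)
    (hgap : ∀ j, p j + 2 * r (j + 1) < p (j + 1)) {m n J : ℕ}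
    {g k : Perm ℕ ≀ᵣ Multiplicative ℤ} (hg : IsLocal p m g) (hk : IsLocal p n k)
    (hmn : 2 * (m + n) ≤ r (J + 1)) : ⁅g, k⁆ ^ (J + 2).factorial = 1 := by
  have hloc : IsLocal p (m + n + m + n) ⁅g, k⁆ := ((hg.mul hk).mul hg.inv).mul hk.inv
  have hright : ⁅g, k⁆.right = 1 := by
    simp [commutatorElement_def]
  obtain ⟨h1, h2⟩ := pow_left hright (J + 2).factorial
  ext1
  · rw [h1]
    funext x
    exact pow_factorial_eq_one_of_mem_window hp hr hgap (by omega) (hloc.2.1 x)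
  · exact h2

/-! ### Lawlessness. -/

/-- Shifting `lamps p` back by `p j` puts `lamp j` at the origin; its other positions do not affect
conjugation of an element supported there. -/
theorem conj_lamp_mem {p : ℕ → ℕ} (hp : StrictMono p) (j : ℕ) {g : Perm ℕ}
    (hg : atOrigin g ∈ lampGroup p) : atOrigin (lamp j * g * lamp j) ∈ lampGroup p := by
  have hinj : Function.Injective (fun j => Multiplicative.ofAdd (p j : ℤ)) := fun i j h =>
    hp.injective (by simpa using h)
  have hs : shift ∈ lampGroup p := Subgroup.subset_closure (by simp [gens])
  have ha : lamps p ∈ lampGroup p := Subgroup.subset_closure (by simp [gens])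
  have hpow : ∀ n : ℕ, shift ^ n = ⟨1, Multiplicative.ofAdd (n : ℤ)⟩ := by
    intro n
    induction n with
    | zero => rfl
    | succ n ih =>
      rw [pow_succ, ih]
      ext <;> simp [shift, ofAdd_add]
  have hu : (shift ^ p j)⁻¹ * lamps p * shift ^ p j ∈ lampGroup p :=
    mul_mem (mul_mem (inv_mem (pow_mem hs _)) ha) (pow_mem hs _)
  set u := (shift ^ p j)⁻¹ * lamps p * shift ^ p j with hudef
  have hur : u.right = 1 := by simp [hudef, lamps]
  have hul : u.left 1 = lamp j := by
    have := hinj.extend_apply lamp 1 j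
    simpa [hudef, hpow, lamps] using this
  have : atOrigin (lamp j * g * lamp j) = u * atOrigin g * u⁻¹ := by
    have hinv : (lamp j)⁻¹ = lamp j := inv_eq_of_mul_eq_one_left (lamp_mul_self j)
    refine RegularWreathProduct.ext ?_ ?_
    · funext x
      by_cases hx : x = 1
      · subst hx
        simp [atOrigin, hur, hul, hinv]
      · simp [atOrigin, hur, hx]
    · simp [atOrigin, hur]
  rw [this]
  exact mul_mem (mul_mem hu hg) (inv_mem hu)

theorem atOrigin_swap_mem {p : ℕ → ℕ} (hp : StrictMono p) (x y : ℕ) :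
    atOrigin (swap x y) ∈ lampGroup p := by
  have h01 : atOrigin (swap 0 1) ∈ lampGroup p := Subgroup.subset_closure (by simp [gens, lamp])
  have h1 : ∀ n, atOrigin (swap 1 n) ∈ lampGroup p := by
    intro n
    rcases n with _ | _ | n
    · rwa [swap_comm]
    · rw [zero_add, swap_self, ← Perm.one_def, map_one]; exact one_mem _
    · have := conj_lamp_mem hp (n + 1) h01
      have he : lamp (n + 1) * swap 0 1 * lamp (n + 1) = swap 1 (n + 2) := by
        unfold lamp
        rw [swap_comm 0 1, swap_mul_swap_mul_swap one_ne_zero (by omega), swap_comm]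
      rwa [he] at this
  by_cases hxy : x = y
  · subst hxy; rw [swap_self, ← Perm.one_def, map_one]; exact one_mem _
  by_cases hx : x = 1
  · subst hx; exact h1 y
  by_cases hy : y = 1
  · subst hy; rw [swap_comm]; exact h1 x
  have he : swap 1 y * swap 1 x * swap 1 y = swap x y := by
    rw [swap_comm 1 x, swap_mul_swap_mul_swap hx hxy, swap_comm]
  rw [← he, map_mul, map_mul]
  exact mul_mem (mul_mem (h1 _) (h1 _)) (h1 _)

theorem isLawless_lampGroup {p : ℕ → ℕ} (hp : StrictMono p) : IsLawless (lampGroup p) := by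
  intro k
  rw [Set.eq_empty_iff_forall_notMem]
  rintro w ⟨hw, hlaw⟩
  obtain ⟨X, hX, σ, hσ⟩ := FreeGroup.exists_perm_lift_ne_one w hw
  obtain ⟨ι⟩ : Nonempty (X ↪ ℕ) :=
    ⟨(Finite.equivFin X).toEmbedding.trans Fin.valEmbedding⟩
  have hinj : Function.Injective atOrigin := fun g h hgh => by
    simpa [atOrigin] using congrArg (fun u => u.left 1) hgh
  let θ : Perm X →* Perm ℕ ≀ᵣ Multiplicative ℤ := atOrigin.comp (Perm.viaEmbeddingHom ι)
  have hθ : ∀ τ, θ τ ∈ lampGroup p := fun τ =>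
    viaEmbeddingHom_mem_of_swap_mem ι ((lampGroup p).comap atOrigin) (atOrigin_swap_mem hp) τ
  have h1 := congrArg Subtype.val (hlaw ((θ.codRestrict _ hθ).comp (FreeGroup.lift σ)))
  have h2 : θ (FreeGroup.lift σ w) = 1 := h1
  exact hσ (Perm.viaEmbeddingHom_injective ι (hinj (by simpa [θ] using h2)))

/-! ### Elementary amenability. -/

/-- The translation part of an element of `lampGroup p`. -/
def translation (p : ℕ → ℕ) : lampGroup p →* Multiplicative ℤ :=
  rightHom.comp (lampGroup p).subtype

/-- The configuration of lamps of an element of the base group. -/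
def config (p : ℕ → ℕ) : (translation p).ker →* (Multiplicative ℤ → Perm ℕ) where
  toFun g := g.1.1.left
  map_one' := rfl
  map_mul' g h := by
    have : g.1.1.right = 1 := g.2
    simp [this]

theorem config_injective (p : ℕ → ℕ) : Function.Injective (config p) := fun g h hgh => by
  have hg : g.1.1.right = 1 := g.2
  have hh : h.1.1.right = 1 := h.2
  exact Subtype.ext (Subtype.ext (RegularWreathProduct.ext hgh (hg.trans hh.symm)))

/-- The configuration of lamps up to finitely many positions. -/
def configGerm (p : ℕ → ℕ) :
    (translation p).ker →* Filter.Germ (Filter.cofinite : Filter (Multiplicative ℤ)) (Perm ℕ) :=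
  (Filter.Germ.coeMulHom _).comp (config p)

theorem sq_eq_one_of_mem_range_configGerm {p r : ℕ → ℕ} (hp : StrictMono p) (hp0 : p 0 = 0)
    (hr : Monotone r) (hr' : ∀ j, j ≤ r j) (hgap : ∀ j, p j + 2 * r (j + 1) < p (j + 1))
    (g : (configGerm p).range) : g ^ 2 = 1 := by
  obtain ⟨_, g, rfl⟩ := g
  obtain ⟨n, hn⟩ := exists_isLocal hp hp0 g.1.2
  apply Subtype.ext
  change (configGerm p g) ^ 2 = 1
  rw [← map_pow]
  refine Filter.Germ.coe_eq.2 ?_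
  have hfin : {x : Multiplicative ℤ | |x.toAdd| ≤ p n + n}.Finite :=
    (Set.finite_Icc (-(p n + n : ℤ)) (p n + n)).preimage
      (f := Multiplicative.toAdd) Multiplicative.toAdd.injective.injOn |>.subset
      fun x hx => abs_le.1 hx
  filter_upwards [hfin.compl_mem_cofinite] with x hx
  rw [map_pow]
  change g.1.1.left x ^ 2 = 1
  have hx' : (p n + n : ℤ) < |x.toAdd| := not_le.1 hx
  -- Far from the origin, the alternative with only indices at most `n` leaves no lamp at all.
  rcases window_dichotomy hp hr hgap ((Nat.le_succ n).trans (hr' (n + 1))) x with ⟨i, hi⟩ | h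
  · exact sq_eq_one_of_mem_zpowers (hi (hn.2.1 x))
  · have hbot : window p n x = ⊥ := by
      rw [window, Subgroup.closure_eq_bot_iff]
      rintro _ ⟨j, hj, rfl⟩
      have h1 : p j ≤ p n := hp.monotone (h j hj)
      have h2 := abs_le.1 hj
      rcases lt_abs.1 hx' with h3 | h3 <;> omega
    have := hn.2.1 x
    rw [hbot, Subgroup.mem_bot] at this
    rw [this, one_pow]

/-- Trivial germ means finite support, and locality then bounds the lamp indices involved; each `T
M` is finite. -/
theorem isElementaryAmenable_ker_configGerm {p : ℕ → ℕ} (hp : StrictMono p) (hp0 : p 0 = 0) :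
    IsElementaryAmenable (configGerm p).ker := by
  let T : ℕ → Subgroup (Multiplicative ℤ → Perm ℕ) := fun M =>
    { carrier := {φ | ∀ x, φ x ∈ Subgroup.closure (lamp '' Set.Iic M) ∧
        ((M : ℤ) < |x.toAdd| → φ x = 1)}
      one_mem' := fun x => ⟨one_mem _, fun _ => rfl⟩
      mul_mem' := fun {φ ψ} hφ hψ x => ⟨mul_mem (hφ x).1 (hψ x).1, fun h => by
        rw [Pi.mul_apply, (hφ x).2 h, (hψ x).2 h, one_mul]⟩
      inv_mem' := fun {φ} hφ x => ⟨inv_mem (hφ x).1, fun h => by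
        rw [Pi.inv_apply, (hφ x).2 h, inv_one]⟩ }
  have hT : Monotone T := fun M M' hM φ hφ x =>
    ⟨Subgroup.closure_mono (Set.image_mono (Set.Iic_subset_Iic.2 hM)) (hφ x).1,
      fun h => (hφ x).2 (by omega)⟩
  have hTfin : ∀ M, Finite (T M) := fun M => by
    have hfin : {x : Multiplicative ℤ | |x.toAdd| ≤ M}.Finite :=
      (Set.finite_Icc (-(M : ℤ)) M).preimage
        (f := Multiplicative.toAdd) Multiplicative.toAdd.injective.injOn |>.subset
        fun x hx => abs_le.1 hx
    have := hfin.to_subtype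
    refine Finite.of_injective (β := {x : Multiplicative ℤ | |x.toAdd| ≤ M} →
      Subgroup.closure (lamp '' Set.Iic M)) (fun φ x => ⟨φ.1 x.1, (φ.2 x.1).1⟩) ?_
    intro φ ψ h
    apply Subtype.ext
    funext x
    by_cases hx : |x.toAdd| ≤ M
    · exact congrArg Subtype.val (congrFun h ⟨x, hx⟩)
    · rw [(φ.2 x).2 (not_le.1 hx), (ψ.2 x).2 (not_le.1 hx)]
  let F : (configGerm p).ker →* (Multiplicative ℤ → Perm ℕ) :=
    (config p).comp (configGerm p).ker.subtype
  have hF : Function.Injective F := (config_injective p).comp Subtype.val_injective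
  refine IsElementaryAmenable.of_directed_union (fun M => (T M).comap F)
    (fun M M' hM => Subgroup.comap_mono (hT hM)) (fun g => ?_) (fun M => ?_)
  · obtain ⟨n, hn⟩ := exists_isLocal hp hp0 g.1.1.2
    have h1 : ∀ᶠ x in Filter.cofinite, g.1.1.1.left x = 1 := Filter.Germ.coe_eq.1 g.2
    have h2 : (Multiplicative.toAdd '' {x | ¬ g.1.1.1.left x = 1}).Finite :=
      (Filter.eventually_cofinite.1 h1).image _
    obtain ⟨B, hB⟩ := (h2.image (fun z : ℤ => |z|)).bddAbove
    have hsupp : ∀ x, (B.toNat : ℤ) < |x.toAdd| → g.1.1.1.left x = 1 := by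
      intro x hx
      by_contra hne
      have : |x.toAdd| ≤ B := hB ⟨_, ⟨x, hne, rfl⟩, rfl⟩
      omega
    refine ⟨B.toNat + n, fun x => ⟨?_, fun hx => hsupp x (by push_cast at hx; omega)⟩⟩
    by_cases hx : (B.toNat : ℤ) < |x.toAdd|
    · change g.1.1.1.left x ∈ _
      rw [hsupp x hx]; exact one_mem _
    -- Indices are bounded because `i ≤ p i`.
    · refine window_le_closure p (fun i hi => ?_) (hn.2.1 x)
      have h3 := hp.le_apply (x := i)
      have h4 := abs_le.1 hi
      have h5 := abs_le.1 (not_lt.1 hx)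
      omega
  · have : Finite ((T M).comap F) :=
      Finite.of_injective (β := T M) (fun g => ⟨F g.1, g.2⟩) fun g h hgh =>
        Subtype.ext (hF (congrArg Subtype.val hgh))
    exact .of_finite _

theorem isElementaryAmenable_lampGroup {p r : ℕ → ℕ} (hp : StrictMono p) (hp0 : p 0 = 0)
    (hr : Monotone r) (hr' : ∀ j, j ≤ r j) (hgap : ∀ j, p j + 2 * r (j + 1) < p (j + 1)) :
    IsElementaryAmenable (lampGroup p) :=
  .of_ker_of_range (translation p)
    (.of_ker_of_range (configGerm p) (isElementaryAmenable_ker_configGerm hp hp0)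
      (.of_sq_eq_one (sq_eq_one_of_mem_range_configGerm hp hp0 hr hr' hgap)))
    (.of_injective (translation p).range.subtype Subtype.val_injective .int)

/-! ### The lower bound on lawlessness growth. -/

/-- The generating set of `lampGroup p`, as a set of elements of that group. -/
def generators (p : ℕ → ℕ) : Set (lampGroup p) := Subtype.val ⁻¹' gens p

theorem finite_generators (p : ℕ → ℕ) : (generators p).Finite :=
  Set.Finite.preimage Subtype.val_injective.injOn (by simp [gens])

theorem closure_generators (p : ℕ → ℕ) : Subgroup.closure (generators p) = ⊤ :=
  Subgroup.closure_closure_coe_preimage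

theorem isLocal_wordLength {p : ℕ → ℕ} (hp : StrictMono p) (hp0 : p 0 = 0) (g : lampGroup p) :
    IsLocal p (wordLength (generators p) g) g.1 := by
  have hg : g ∈ (Subgroup.closure (generators p)).toSubmonoid :=
    closure_generators p ▸ Subgroup.mem_top g
  rw [Subgroup.closure_toSubmonoid] at hg
  obtain ⟨v, hv, hvg⟩ := Submonoid.exists_list_of_mem_closure hg
  obtain ⟨u, hu, hug, hlen⟩ := Nat.sInf_mem (s := {n : ℕ | ∃ u : List (lampGroup p),
    (∀ x ∈ u, x ∈ generators p ∨ x⁻¹ ∈ generators p) ∧ u.prod = g ∧ u.length = n})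
    ⟨_, v, hv, hvg, rfl⟩
  have hloc := IsLocal.list_prod (p := p) (u.map Subtype.val) (by
    intro x hx
    obtain ⟨y, hy, rfl⟩ := List.mem_map.1 hx
    rcases hu y hy with h | h
    · exact isLocal_of_mem_gens hp hp0 h
    · simpa using (isLocal_of_mem_gens hp hp0 h).inv)
  rw [List.length_map, hlen] at hloc
  have : (u.map Subtype.val).prod = g.1 := by
    rw [← hug]; exact (map_list_prod (lampGroup p).subtype u).symm
  rwa [this] at hloc

theorem le_lawlessnessGrowth {p r : ℕ → ℕ} (hp : StrictMono p) (hp0 : p 0 = 0) (hr : Monotone r)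
    (hgap : ∀ j, p j + 2 * r (j + 1) < p (j + 1)) {k : ℕ} (hk : 2 ≤ k) (J R : ℕ)
    (hR : 2 * R ≤ r (J + 1)) (l : ℕ+) (hl : 4 * (J + 2).factorial ≤ l) :
    R ≤ lawlessnessGrowth (generators p) k l := by
  let a : FreeGroup (Fin k) := .of ⟨0, by omega⟩
  let b : FreeGroup (Fin k) := .of ⟨1, by omega⟩
  let w : FreeGroup (Fin k) := ⁅a, b⁆ ^ (J + 2).factorial
  have hab : ⁅a, b⁆ ≠ 1 := by
    rw [Ne, commutatorElement_eq_one_iff_mul_comm]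
    intro h
    have h1 := congrArg FreeGroup.toWord h
    simp [a, b, FreeGroup.of, FreeGroup.mul_mk, FreeGroup.toWord_mk, FreeGroup.reduce] at h1
  have hw : w ≠ 1 := by
    rw [Ne, pow_eq_one_iff_left (Nat.factorial_ne_zero _)]
    exact hab
  have hnorm : w.norm ≤ l := by
    refine le_trans ?_ hl
    have h4 : ⁅a, b⁆.norm ≤ 4 := by
      have h1 := FreeGroup.norm_mul_le (a * b * a⁻¹) b⁻¹
      have h2 := FreeGroup.norm_mul_le (a * b) a⁻¹
      have h3 := FreeGroup.norm_mul_le a b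
      simp only [FreeGroup.norm_inv_eq, a, b, FreeGroup.norm_of] at h1 h2 h3
      simp only [commutatorElement_def, a, b]
      omega
    have : ∀ N, (⁅a, b⁆ ^ N).norm ≤ 4 * N := by
      intro N
      induction N with
      | zero => simp
      | succ N ih =>
        rw [pow_succ]
        exact (FreeGroup.norm_mul_le _ _).trans (by omega)
    exact this _
  have hfin : {w : FreeGroup (Fin k) | w ∈ {w : FreeGroup (Fin k) | w ≠ 1} ∧
      w.norm ≤ (l : ℕ)}.Finite := (FreeGroup.finite_norm_le (l : ℕ)).subset fun _ h => h.2
  refine le_trans ?_ (le_csSup (hfin.image _).bddAbove ⟨w, ⟨hw, hnorm⟩, rfl⟩)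
  -- As `sInf ∅ = 0`, some tuple not killing `w` must exist: lawlessness is needed here.
  refine le_csInf ?_ ?_
  · have hlaw : w ∉ groupLaws (lampGroup p) k := by
      rw [isLawless_lampGroup hp k]; exact Set.notMem_empty w
    simp only [groupLaws, Set.mem_ofPred_eq, not_and, not_forall] at hlaw
    obtain ⟨π, hπ⟩ := hlaw hw
    refine ⟨_, fun i => π (.of i), ?_, rfl⟩
    rwa [show FreeGroup.lift (fun i => π (.of i)) = π from FreeGroup.ext_hom _ _ (by simp)]
  · rintro _ ⟨g, hg, rfl⟩
    by_contra! hlt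
    refine hg ?_
    have hsum : wordLength (generators p) (g ⟨0, by omega⟩) +
        wordLength (generators p) (g ⟨1, by omega⟩) ≤ ∑ i, wordLength (generators p) (g i) := by
      rw [← Finset.sum_pair (f := fun i => wordLength (generators p) (g i))
        (a := (⟨0, by omega⟩ : Fin k)) (b := ⟨1, by omega⟩) (by simp)]
      exact Finset.sum_le_sum_of_subset (Finset.subset_univ _)
    have := commutator_pow_eq_one (J := J) hp hr hgap
      (isLocal_wordLength hp hp0 (g ⟨0, by omega⟩))
      (isLocal_wordLength hp hp0 (g ⟨1, by omega⟩)) (by omega)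
    apply Subtype.ext
    simp only [w, a, b, map_pow, map_commutatorElement, FreeGroup.lift_apply_of]
    exact this

end SparseLamp

/-! ### Choice of the parameters. -/

theorem mainTheorem3 (f : ℕ+ → ℕ) (hf : Monotone f) (hunb : ¬ BddAbove (Set.range f)) :
    ∃ (Γ : Type) (_ : Group Γ) (S : Set Γ),
      IsElementaryAmenable Γ ∧ IsLawless Γ ∧
      S.Finite ∧ Subgroup.closure S = ⊤ ∧
      ∀ k : ℕ, 2 ≤ k → GrowthLE f (lawlessnessGrowth S k) := by
  -- `c j` bounds the length of `⁅a, b⁆ ^ (j + 2)!`. The term `2 * f (c j)` in `r` forces complexity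
  -- `f (c j)`, the summand `j` makes the gaps tend to infinity, and `+ 1` in `p` makes them strict.
  let c : ℕ → ℕ+ := fun j => ⟨4 * (j + 2).factorial, by positivity⟩
  let r : ℕ → ℕ := fun j => 2 * f (c j) + j
  let p : ℕ → ℕ := fun j => ∑ i ∈ Finset.range j, (2 * r (i + 1) + 1)
  have hc : Monotone c := fun i j hij =>
    Nat.mul_le_mul_left 4 (Nat.factorial_le (by omega))
  have hr : Monotone r := fun i j hij =>
    Nat.add_le_add (Nat.mul_le_mul_left 2 (hf (hc hij))) hij
  have hr' : ∀ j, j ≤ r j := fun j => Nat.le_add_left _ _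
  have hgap : ∀ j, p j + 2 * r (j + 1) < p (j + 1) := fun j => by
    simp only [p, Finset.sum_range_succ]; omega
  have hp : StrictMono p := strictMono_nat_of_lt_succ fun j => by have := hgap j; omega
  have hp0 : p 0 = 0 := rfl
  refine ⟨SparseLamp.lampGroup p, inferInstance, SparseLamp.generators p,
    SparseLamp.isElementaryAmenable_lampGroup hp hp0 hr hr' hgap,
    SparseLamp.isLawless_lampGroup hp, SparseLamp.finite_generators p,
    SparseLamp.closure_generators p, fun k hk => ⟨c 0, fun l => ?_⟩⟩
  -- Take the least such `J`, so `c J ≤ c 0 * l < c (J + 1)`; the factor `c 0` covers `J = 0`.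
  have hex : ∃ J, c 0 * l < c (J + 1) := ⟨(c 0 * l : ℕ+), by
    change ((c 0 * l : ℕ+) : ℕ) < 4 * ((c 0 * l : ℕ+) + 1 + 2 : ℕ).factorial
    have := Nat.self_le_factorial ((c 0 * l : ℕ+) + 1 + 2 : ℕ)
    omega⟩
  classical
  let J := Nat.find hex
  have hJ : c 0 * l < c (J + 1) := Nat.find_spec hex
  have hJ' : c J ≤ c 0 * l := by
    rcases Nat.eq_zero_or_pos J with h | h
    · rw [h]; exact le_mul_of_one_le_right' one_le
    · have := Nat.find_min hex (m := J - 1) (by omega)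
      rwa [not_lt, Nat.sub_add_cancel h] at this
  have hfl : f l ≤ f (c (J + 1)) :=
    hf ((le_mul_of_one_le_left' one_le).trans hJ.le)
  refine hfl.trans (le_trans ?_ (Nat.le_mul_of_pos_left _ (c 0).pos))
  exact SparseLamp.le_lawlessnessGrowth hp hp0 hr hgap hk J _ (Nat.le_add_right _ _) _ hJ'
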